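/- Consider the system $x_{k+1}=f(x_k,u_k)+w_k$ with $x_k,w_k\in\mathbb{R}^n$, $u_k\in\mathbb{R}^m$, symmetric positive definite weights $Q,R$, and a feasible reference trajectory $(x_r(k),u_r(k))_{k\ge 0}$, i.e. $x_r(k+1)=f(x_r(k),u_r(k))$ for all $k$. Write $|\cdot|$ for the Euclidean norm and $|z|_Q^2=z^\top Qz$. For a horizon $N\ge 1$ let $$V_N(x,k)=\min_{u_{0|k},\dots,u_{N-1|k}}\ \sum_{i=0}^{N-1}\Big(|x_{i|k}-x_r(k+i)|_Q^2+|u_{i|k}-u_r(k+i)|_R^2\Big),\qquad x_{0|k}=x,\quad x_{i+1|k}=f(x_{i|k},u_{i|k}).$$ (If the minimum is not attained, $V_N$ denotes the infimum.) A perturbed closed loop is a sequence with $x_{k+1}=f(x_k,u^\star_{0|k})+w_k$ for all $k\ge0$, where $u^\star_{0|k}$ is the first element of a minimizing control sequence for the state $x_k$ at time $k$. Assume local incremental stabilizability: there exist $\kappa:\mathbb{R}^n\times\mathbb{R}^n\times\mathbb{R}^m\to\mathbb{R}^m$, a function $V_\delta:\mathbb{R}^n\times\mathbb{R}^n\times\mathbb{R}^m\to\mathbb{R}_{\ge0}$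 that is continuous in its first argument with $V_\delta(x',x',u')=0$ for all $(x',u')$, and constants $c_{\delta,l},c_{\delta,u},\delta_{loc},k_{max}>0$, $\rho\in(0,1)$, such that for all $(x,x',u')$ with $V_\delta(x,x',u')\le\delta_{loc}$ and all $u'^+\in\mathbb{R}^m$, $$c_{\delta,l}|x-x'|^2\le V_\delta(x,x',u')\le c_{\delta,u}|x-x'|^2,\quad |\kappa(x,x',u')-u'|\le k_{max}|x-x'|,\quad V_\delta(x^+,x'^+,u'^+)\le\rho V_\delta(x,x',u'),$$ where $x^+=f(x,\kappa(x,x',u'))$ and $x'^+=f(x',u')$. Then for every $c_x>0$ there exist $\bar w>0$ and $N_0\ge1$ such that for every horizon $N\ge N_0$ there are a $\mathcal{K}$-function $V_{RPI}=V_{RPI}(\cdot;N,c_x)$ (that is, $V_{RPI}:[0,\infty)\to[0,\infty)$ is continuous and strictly increasing with $V_{RPI}(0)=0$) and constants $C>0$, $\lambda\in(0,1)$ with the following property. For every disturbance level $b\in[0,\bar w]$, every disturbance sequence with $|w_k|\le b$ for all $k$, and every perturbed closed loop with $|x_0-x_r(0)|\le c_x$, the tracking error converges exponentially to the sets $\mathcal{Z}_{RPI}(k)=\{x-x_r(k):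 V_N(x,k)\le V_{RPI}(b)\}$: $$\operatorname{dist}\big(x_k-x_r(k),\mathcal{Z}_{RPI}(k)\big)\le C\lambda^k\operatorname{dist}\big(x_0-x_r(0),\mathcal{Z}_{RPI}(0)\big)\qquad\text{for all }k\ge0 .$$ -/

import Mathlib

open scoped Matrix

/-- The weighted square `|x|_Q² = xᵀ Q x`. -/
noncomputable def weightedSq {d : ℕ} (Q : Matrix (Fin d) (Fin d) ℝ)
    (x : EuclideanSpace ℝ (Fin d)) : ℝ :=
  WithLp.ofLp x ⬝ᵥ (Q *ᵥ WithLp.ofLp x)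

/-- Nominal (undisturbed) state prediction: `x_{0|k} = x`,
`x_{i+1|k} = f (x_{i|k}, u_{i|k})`. -/
def predictedState {n m : ℕ}
    (f : EuclideanSpace ℝ (Fin n) → EuclideanSpace ℝ (Fin m) → EuclideanSpace ℝ (Fin n))
    (x : EuclideanSpace ℝ (Fin n)) (u : ℕ → EuclideanSpace ℝ (Fin m)) :
    ℕ → EuclideanSpace ℝ (Fin n)
  | 0 => x
  | i + 1 => f (predictedState f x u i) (u i)

/-- The data of the tracking control problem: dynamics `f`, state weight `Q`, input weight `R`,
and the reference state and input trajectories `xr`, `ur`. -/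
structure TrackingMPC (n m : ℕ) where
  f : EuclideanSpace ℝ (Fin n) → EuclideanSpace ℝ (Fin m) → EuclideanSpace ℝ (Fin n)
  Q : Matrix (Fin n) (Fin n) ℝ
  R : Matrix (Fin m) (Fin m) ℝ
  xr : ℕ → EuclideanSpace ℝ (Fin n)
  ur : ℕ → EuclideanSpace ℝ (Fin m)

namespace TrackingMPC

variable {n m : ℕ} (P : TrackingMPC n m)

/-- The reference is a trajectory of the undisturbed system. -/
def FeasibleReference : Prop :=
  ∀ k, P.xr (k + 1) = P.f (P.xr k) (P.ur k)

/-- The finite-horizon cost `J_N(x, u, k)`. Control sequences are indexed by `ℕ`; only the entries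
`u 0, …, u (N - 1)` enter the cost. -/
noncomputable def cost (N : ℕ) (x : EuclideanSpace ℝ (Fin n))
    (u : ℕ → EuclideanSpace ℝ (Fin m)) (k : ℕ) : ℝ :=
  ∑ i ∈ Finset.range N,
    (weightedSq P.Q (predictedState P.f x u i - P.xr (k + i)) +
      weightedSq P.R (u i - P.ur (k + i)))

/-- The value function `V_N(x, k)`. For positive definite weights the cost is nonnegative, so this
is a genuine infimum; it is the minimum whenever a minimizer exists. -/
noncomputable def value (N : ℕ) (x : EuclideanSpace ℝ (Fin n)) (k : ℕ) : ℝ :=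
  ⨅ u : ℕ → EuclideanSpace ℝ (Fin m), P.cost N x u k

/-- `u` minimizes `J_N(x, ·, k)`. -/
def IsOptimal (N : ℕ) (x : EuclideanSpace ℝ (Fin n)) (k : ℕ)
    (u : ℕ → EuclideanSpace ℝ (Fin m)) : Prop :=
  ∀ v : ℕ → EuclideanSpace ℝ (Fin m), P.cost N x u k ≤ P.cost N x v k

/-- `x` is a state trajectory of the perturbed closed loop with disturbance `w`: at every time `k`
the first input of a minimizing control sequence is applied. -/
def IsClosedLoop (N : ℕ) (w x : ℕ → EuclideanSpace ℝ (Fin n)) : Prop :=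
  ∀ k, ∃ u : ℕ → EuclideanSpace ℝ (Fin m),
    P.IsOptimal N (x k) k u ∧ x (k + 1) = P.f (x k) (u 0) + w k

/-- The set of tracking errors `{x - x_r(k) : V_N(x, k) ≤ v}` at time `k`. -/
def errorSublevel (N : ℕ) (k : ℕ) (v : ℝ) : Set (EuclideanSpace ℝ (Fin n)) :=
  {e | ∃ x : EuclideanSpace ℝ (Fin n), e = x - P.xr k ∧ P.value N x k ≤ v}

end TrackingMPC

/-- Local incremental stabilizability. The successor reference input `u'⁺` is an arbitrary input:
it is the next input of whatever reference is being tracked. -/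
def LocallyIncrementallyStabilizable {n m : ℕ}
    (f : EuclideanSpace ℝ (Fin n) → EuclideanSpace ℝ (Fin m) → EuclideanSpace ℝ (Fin n)) :
    Prop :=
  ∃ (κ : EuclideanSpace ℝ (Fin n) → EuclideanSpace ℝ (Fin n) → EuclideanSpace ℝ (Fin m) →
        EuclideanSpace ℝ (Fin m))
    (V : EuclideanSpace ℝ (Fin n) → EuclideanSpace ℝ (Fin n) → EuclideanSpace ℝ (Fin m) → ℝ)
    (cl cu δloc kmax ρ : ℝ),
    (∀ x x' u', 0 ≤ V x x' u') ∧
    (∀ x' u', Continuous fun x => V x x' u') ∧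
    (∀ x' u', V x' x' u' = 0) ∧
    0 < cl ∧ 0 < cu ∧ 0 < δloc ∧ 0 < kmax ∧ 0 < ρ ∧ ρ < 1 ∧
    ∀ x x' u', V x x' u' ≤ δloc →
      cl * ‖x - x'‖ ^ 2 ≤ V x x' u' ∧
      V x x' u' ≤ cu * ‖x - x'‖ ^ 2 ∧
      ‖κ x x' u' - u'‖ ≤ kmax * ‖x - x'‖ ∧
      ∀ u'next, V (f x (κ x x' u')) (f x' u') u'next ≤ ρ * V x x' u'

/-- Class-`𝒦` functions `[0, ∞) → [0, ∞)`: continuous, strictly increasing, zero at zero. -/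
def IsClassK (α : ℝ → ℝ) : Prop :=
  ContinuousOn α (Set.Ici 0) ∧ StrictMonoOn α (Set.Ici 0) ∧ α 0 = 0

/-! Everything is run on `W = √V_N`, which is globally Lipschitz. Local stabilizability already
gives global tracking: a long segment is cut into short pieces, each piece is tracked along the
previous one, and since both errors and lengths add, the constants do not grow
(`LocallyIncrementallyStabilizable.exists_canTrack`). Minkowski's inequality turns this into a
Lipschitz constant `L` independent of horizon and time (`sqrt_value_le`).

Comparison with the reference bounds the cost by a multiple of the first stage cost, so for a long
horizon the undisturbed loop contracts `V_N` (`exists_cost_le_mul`), and under disturbance `W⁺ ≤ μ W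
+ L‖w‖`.

With `s` twice the limit level `L b / (1 - μ)`, `W` either falls below `s` or decays geometrically.
A start just outside the sublevel set has small distance but not small `W`; it enters in one step.
In the remaining case `s` is less than a fixed fraction of `W 0`, so `W 0` is bounded by a multiple
of the distance. -/

lemma sqrt_sum_add_sq_le {ι : Type*} (s : Finset ι) (a b : ι → ℝ)
    (ha : ∀ i, 0 ≤ a i) (hb : ∀ i, 0 ≤ b i) :
    √(∑ i ∈ s, (a i + b i) ^ 2) ≤ √(∑ i ∈ s, a i ^ 2) + √(∑ i ∈ s, b i ^ 2) := by
  have h := Real.Lp_add_le_of_nonneg s (f := a) (g := b) (p := 2) (by norm_num)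
    (fun i _ => ha i) (fun i _ => hb i)
  simpa [Real.sqrt_eq_rpow] using h

/-! ### Weighted squares as squared norms. -/

open scoped MatrixOrder Matrix.Norms.L2Operator in
lemma Matrix.PosDef.exists_weightedSq_eq {d : ℕ} {Q : Matrix (Fin d) (Fin d) ℝ} (hQ : Q.PosDef) :
    ∃ A : EuclideanSpace ℝ (Fin d) →L[ℝ] EuclideanSpace ℝ (Fin d),
      (∀ x, weightedSq Q x = ‖A x‖ ^ 2) ∧ ∃ c : ℝ, 0 < c ∧ ∀ x, c * ‖x‖ ≤ ‖A x‖ := by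
  obtain ⟨B, hB⟩ : ∃ B : Matrix (Fin d) (Fin d) ℝ, Q = Bᴴ * B :=
    CStarAlgebra.nonneg_iff_eq_star_mul_self.mp hQ.posSemidef.nonneg
  have hA : ∀ x, weightedSq Q x = ‖Matrix.toEuclideanCLM (𝕜 := ℝ) B x‖ ^ 2 := by
    intro x
    rw [EuclideanSpace.norm_sq_eq, weightedSq, hB, ← Matrix.mulVec_mulVec, Matrix.dotProduct_mulVec,
      Matrix.conjTranspose_eq_transpose_of_trivial, Matrix.vecMul_transpose]
    simp [dotProduct, sq]
  refine ⟨Matrix.toEuclideanCLM (𝕜 := ℝ) B, hA, ?_⟩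
  have hdet : IsUnit B.det := by
    have h := hQ.det_pos.ne'
    rw [hB, Matrix.det_mul] at h
    exact isUnit_iff_ne_zero.mpr (right_ne_zero_of_mul h)
  set D := Matrix.toEuclideanCLM (𝕜 := ℝ) B⁻¹
  refine ⟨(‖D‖ + 1)⁻¹, by positivity, fun x => ?_⟩
  have hx : x = D (Matrix.toEuclideanCLM (𝕜 := ℝ) B x) := by
    rw [← mul_apply_eq_comp, ← map_mul, Matrix.nonsing_inv_mul _ hdet, map_one]
    rfl
  rw [inv_mul_le_iff₀ (by positivity)]
  calc ‖x‖ = ‖D (Matrix.toEuclideanCLM (𝕜 := ℝ) B x)‖ := by rw [← hx]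
    _ ≤ ‖D‖ * ‖Matrix.toEuclideanCLM (𝕜 := ℝ) B x‖ := D.le_opNorm _
    _ ≤ _ := by gcongr; linarith

/-! ### From local stabilizability to global tracking. -/

section Tracking

variable {n m : ℕ}
  {f : EuclideanSpace ℝ (Fin n) → EuclideanSpace ℝ (Fin m) → EuclideanSpace ℝ (Fin n)}

/-- The trajectory of `f` from `x` under a feedback that follows the trajectory `y` with
inputs `u`. -/
def trackingState
    (f : EuclideanSpace ℝ (Fin n) → EuclideanSpace ℝ (Fin m) → EuclideanSpace ℝ (Fin n))
    (κ : EuclideanSpace ℝ (Fin n) → EuclideanSpace ℝ (Fin n) → EuclideanSpace ℝ (Fin m) →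
        EuclideanSpace ℝ (Fin m))
    (x : EuclideanSpace ℝ (Fin n)) (y : ℕ → EuclideanSpace ℝ (Fin n))
    (u : ℕ → EuclideanSpace ℝ (Fin m)) : ℕ → EuclideanSpace ℝ (Fin n)
  | 0 => x
  | i + 1 => f (trackingState f κ x y u i) (κ (trackingState f κ x y u i) (y i) (u i))

lemma predictedState_feedback
    (κ : EuclideanSpace ℝ (Fin n) → EuclideanSpace ℝ (Fin n) → EuclideanSpace ℝ (Fin m) →
        EuclideanSpace ℝ (Fin m))
    (x : EuclideanSpace ℝ (Fin n)) (y : ℕ → EuclideanSpace ℝ (Fin n))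
    (u : ℕ → EuclideanSpace ℝ (Fin m)) (i : ℕ) :
    predictedState f x (fun i => κ (trackingState f κ x y u i) (y i) (u i)) i =
      trackingState f κ x y u i := by
  induction i with
  | zero => rfl
  | succ i ih => rw [predictedState, ih, trackingState]

/-- From `x` one can follow every trajectory starting at `y` with errors at most
`K * r ^ i * ‖x - y‖` in state and input. -/
def CanTrack
    (f : EuclideanSpace ℝ (Fin n) → EuclideanSpace ℝ (Fin m) → EuclideanSpace ℝ (Fin n))
    (K r : ℝ) (x y : EuclideanSpace ℝ (Fin n)) : Prop :=
  ∀ u : ℕ → EuclideanSpace ℝ (Fin m), ∃ v : ℕ → EuclideanSpace ℝ (Fin m), ∀ i,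
    ‖predictedState f x v i - predictedState f y u i‖ ≤ K * r ^ i * ‖x - y‖ ∧
    ‖v i - u i‖ ≤ K * r ^ i * ‖x - y‖

lemma CanTrack.of_between {K r : ℝ} {x y z : EuclideanSpace ℝ (Fin n)}
    (hxz : CanTrack f K r x z) (hzy : CanTrack f K r z y)
    (h : ‖x - z‖ + ‖z - y‖ = ‖x - y‖) : CanTrack f K r x y := by
  intro u
  obtain ⟨v', hv'⟩ := hzy u
  obtain ⟨v, hv⟩ := hxz v'
  refine ⟨v, fun i => ⟨?_, ?_⟩⟩
  · rw [← h, mul_add]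
    exact (norm_sub_le_norm_sub_add_norm_sub _ _ _).trans (add_le_add (hv i).1 (hv' i).1)
  · rw [← h, mul_add]
    exact (norm_sub_le_norm_sub_add_norm_sub _ _ _).trans (add_le_add (hv i).2 (hv' i).2)

/-- Chaining along the segment from `y` to `x` in steps of length at most `r₀`; collinearity makes
the lengths add exactly, so `K` and `r` survive. -/
lemma canTrack_of_local {K r r₀ : ℝ} (hr₀ : 0 < r₀)
    (hloc : ∀ x y, ‖x - y‖ ≤ r₀ → CanTrack f K r x y) (x y : EuclideanSpace ℝ (Fin n)) :
    CanTrack f K r x y := by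
  have key : ∀ (M : ℕ) (x y : EuclideanSpace ℝ (Fin n)), ‖x - y‖ ≤ (M + 1) * r₀ →
      CanTrack f K r x y := by
    intro M
    induction M with
    | zero => intro x y h; exact hloc x y (by simpa using h)
    | succ M ih =>
      intro x y h
      push_cast at h
      have hM : (0 : ℝ) < M + 1 + 1 := by positivity
      have h1 : x - (y + ((M + 1 : ℝ) / (M + 1 + 1)) • (x - y)) =
          (1 / (M + 1 + 1) : ℝ) • (x - y) := by
        have : (1 / (M + 1 + 1) : ℝ) = 1 - (M + 1 : ℝ) / (M + 1 + 1) := by field_simp; ring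
        rw [this, sub_smul, one_smul]; abel
      have h2 : (y + ((M + 1 : ℝ) / (M + 1 + 1)) • (x - y)) - y =
          ((M + 1 : ℝ) / (M + 1 + 1)) • (x - y) := by abel
      have n1 : ‖x - (y + ((M + 1 : ℝ) / (M + 1 + 1)) • (x - y))‖ =
          1 / (M + 1 + 1) * ‖x - y‖ := by
        rw [h1, norm_smul, Real.norm_of_nonneg (by positivity)]
      have n2 : ‖(y + ((M + 1 : ℝ) / (M + 1 + 1)) • (x - y)) - y‖ =
          (M + 1) / (M + 1 + 1) * ‖x - y‖ := by
        rw [h2, norm_smul, Real.norm_of_nonneg (by positivity)]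
      -- With `M + 2` equal pieces, this point splits off the one next to `x`.
      refine CanTrack.of_between (z := y + ((M + 1 : ℝ) / (M + 1 + 1)) • (x - y))
        (hloc _ _ ?_) (ih _ _ ?_) ?_
      · rw [n1, div_mul_eq_mul_div, one_mul, div_le_iff₀ hM]; linarith
      · rw [n2, div_mul_eq_mul_div, div_le_iff₀ hM]
        have := mul_le_mul_of_nonneg_left h (by positivity : (0 : ℝ) ≤ M + 1)
        linarith
      · rw [n1, n2]; field_simp; ring
  obtain ⟨M, hM⟩ := exists_nat_ge (‖x - y‖ / r₀)
  refine key M x y ?_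
  rw [div_le_iff₀ hr₀] at hM
  linarith

lemma LocallyIncrementallyStabilizable.exists_canTrack
    (h : LocallyIncrementallyStabilizable f) :
    ∃ K r : ℝ, 0 < K ∧ 0 < r ∧ r < 1 ∧ ∀ x y, CanTrack f K r x y := by
  obtain ⟨κ, V, cl, cu, δ, kmax, ρ, -, hcont, hzero, hcl, hcu, hδ, hkmax, hρ, hρ1, hV⟩ := h
  have hr₀ : 0 < √(δ / (2 * cu)) := Real.sqrt_pos.mpr (by positivity)
  have hsmall : ∀ x y u', ‖x - y‖ ≤ √(δ / (2 * cu)) → V x y u' ≤ δ := by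
    intro x y u' hxy
    by_contra! hlt
    have hg : Continuous fun t : ℝ => V (y + t • (x - y)) y u' :=
      (hcont y u').comp (by fun_prop)
    -- If `V` exceeded `δ` at `x`, it would equal `δ` somewhere on the segment from `y`. The
    -- quadratic upper bound holds there and, by the choice of radius, gives at most `δ / 2`.
    obtain ⟨t, ht, htV⟩ := intermediate_value_Icc (zero_le_one (α := ℝ)) hg.continuousOn
      (show δ ∈ Set.Icc _ _ from ⟨by simpa [hzero] using hδ.le, by simpa using hlt.le⟩)
    have h1 := (hV _ _ _ htV.le).2.1
    simp only at htV
    rw [htV, add_sub_cancel_left, norm_smul, Real.norm_of_nonneg ht.1] at h1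
    have h2 : t * ‖x - y‖ ≤ √(δ / (2 * cu)) :=
      (mul_le_of_le_one_left (norm_nonneg _) ht.2).trans hxy
    have h3 : (t * ‖x - y‖) ^ 2 ≤ δ / (2 * cu) := by
      rw [← Real.sq_sqrt (show 0 ≤ δ / (2 * cu) by positivity)]
      exact pow_le_pow_left₀ (mul_nonneg ht.1 (norm_nonneg _)) h2 2
    have h4 : cu * (t * ‖x - y‖) ^ 2 ≤ cu * (δ / (2 * cu)) := by gcongr
    have h5 : cu * (δ / (2 * cu)) = δ / 2 := by field_simp
    linarith
  -- The quadratic bounds on `V` give the factor `√(cu / cl)`; `kmax + 1` serves state and input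
  -- errors at once.
  refine ⟨√(cu / cl) * (kmax + 1), √ρ, mul_pos (Real.sqrt_pos.mpr (by positivity)) (by positivity),
    Real.sqrt_pos.mpr hρ, by rw [Real.sqrt_lt' one_pos]; simpa using hρ1,
    canTrack_of_local hr₀ fun x y hxy u => ?_⟩
  refine ⟨fun i => κ (trackingState f κ x (predictedState f y u) u i) (predictedState f y u i) (u i),
    fun i => ?_⟩
  rw [predictedState_feedback]
  set z := trackingState f κ x (predictedState f y u) u with hz
  set y' := predictedState f y u with hy'
  have hVi : ∀ i, V (z i) (y' i) (u i) ≤ δ ∧ V (z i) (y' i) (u i) ≤ ρ ^ i * V x y (u 0) := by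
    intro i
    induction i with
    | zero => simpa [hz, hy', trackingState, predictedState] using hsmall x y (u 0) hxy
    | succ i ih =>
      have h1 : V (z (i + 1)) (y' (i + 1)) (u (i + 1)) ≤ ρ * V (z i) (y' i) (u i) :=
        (hV _ _ _ ih.1).2.2.2 (u (i + 1))
      refine ⟨h1.trans ?_, h1.trans ?_⟩
      · calc ρ * V (z i) (y' i) (u i) ≤ ρ * δ := by gcongr; exact ih.1
          _ ≤ δ := mul_le_of_le_one_left hδ.le hρ1.le
      · calc ρ * V (z i) (y' i) (u i) ≤ ρ * (ρ ^ i * V x y (u 0)) := by gcongr; exact ih.2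
          _ = _ := by ring
  have hstate : ‖z i - y' i‖ ≤ √(cu / cl) * √ρ ^ i * ‖x - y‖ := by
    rw [← sq_le_sq₀ (norm_nonneg _) (by positivity)]
    rw [mul_pow, mul_pow, Real.sq_sqrt (by positivity), ← pow_mul, mul_comm i 2, pow_mul,
      Real.sq_sqrt hρ.le]
    have h1 := (hV _ _ _ (hVi i).1).1
    have h2 := (hV x y (u 0) (hsmall x y (u 0) hxy)).2.1
    have h3 : cl * ‖z i - y' i‖ ^ 2 ≤ ρ ^ i * (cu * ‖x - y‖ ^ 2) :=
      h1.trans ((hVi i).2.trans (by gcongr))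
    rw [show cu / cl * ρ ^ i * ‖x - y‖ ^ 2 = ρ ^ i * (cu * ‖x - y‖ ^ 2) / cl by ring,
      le_div_iff₀ hcl]
    linarith
  have hnn : 0 ≤ √(cu / cl) * √ρ ^ i * ‖x - y‖ := by positivity
  constructor
  · nlinarith [mul_nonneg hkmax.le hnn]
  · have h1 := (hV _ _ _ (hVi i).1).2.2.1
    have h2 := mul_le_mul_of_nonneg_left hstate hkmax.le
    nlinarith

end Tracking

/-! ### Costs, value function and its decrease. -/

namespace TrackingMPC

variable {n m : ℕ} (P : TrackingMPC n m)

/-- The stage cost at prediction step `i`, for an optimization started at time `k`. -/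
noncomputable def stageCost (x : EuclideanSpace ℝ (Fin n)) (u : ℕ → EuclideanSpace ℝ (Fin m))
    (k i : ℕ) : ℝ :=
  weightedSq P.Q (predictedState P.f x u i - P.xr (k + i)) + weightedSq P.R (u i - P.ur (k + i))

/-- The control sequence `u 0, …, u (a - 1), v 0, v 1, …`. -/
def concatInput {m : ℕ} (a : ℕ) (u v : ℕ → EuclideanSpace ℝ (Fin m)) :
    ℕ → EuclideanSpace ℝ (Fin m) :=
  fun i => if i < a then u i else v (i - a)

lemma concatInput_of_lt {a i : ℕ} (h : i < a) (u v : ℕ → EuclideanSpace ℝ (Fin m)) :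
    concatInput a u v i = u i := if_pos h

lemma concatInput_add (a i : ℕ) (u v : ℕ → EuclideanSpace ℝ (Fin m)) :
    concatInput a u v (a + i) = v i := by
  simp [concatInput]

lemma predictedState_concatInput_of_le
    (f : EuclideanSpace ℝ (Fin n) → EuclideanSpace ℝ (Fin m) → EuclideanSpace ℝ (Fin n))
    (x : EuclideanSpace ℝ (Fin n)) (u v : ℕ → EuclideanSpace ℝ (Fin m)) {a i : ℕ} (h : i ≤ a) :
    predictedState f x (concatInput a u v) i = predictedState f x u i := by
  induction i with
  | zero => rfl
  | succ i ih => rw [predictedState, predictedState, ih (by omega), concatInput_of_lt (by omega)]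

lemma predictedState_concatInput_add
    (f : EuclideanSpace ℝ (Fin n) → EuclideanSpace ℝ (Fin m) → EuclideanSpace ℝ (Fin n))
    (x : EuclideanSpace ℝ (Fin n)) (u v : ℕ → EuclideanSpace ℝ (Fin m)) (a i : ℕ) :
    predictedState f x (concatInput a u v) (a + i) =
      predictedState f (predictedState f x u a) v i := by
  induction i with
  | zero => exact predictedState_concatInput_of_le f x u v le_rfl
  | succ i ih => rw [← add_assoc, predictedState, ih, concatInput_add, predictedState]

lemma predictedState_succ'
    (f : EuclideanSpace ℝ (Fin n) → EuclideanSpace ℝ (Fin m) → EuclideanSpace ℝ (Fin n))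
    (x : EuclideanSpace ℝ (Fin n)) (u : ℕ → EuclideanSpace ℝ (Fin m)) (i : ℕ) :
    predictedState f x u (i + 1) = predictedState f (f x (u 0)) (fun j => u (j + 1)) i := by
  induction i with
  | zero => rfl
  | succ i ih => rw [predictedState, ih, predictedState]

lemma cost_concatInput (a c : ℕ) (x : EuclideanSpace ℝ (Fin n))
    (u v : ℕ → EuclideanSpace ℝ (Fin m)) (k : ℕ) :
    P.cost (a + c) x (concatInput a u v) k =
      P.cost a x u k + P.cost c (predictedState P.f x u a) v (k + a) := by
  rw [cost, Finset.sum_range_add]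
  congr 1
  · refine Finset.sum_congr rfl fun i hi => ?_
    have hi := Finset.mem_range.mp hi
    rw [predictedState_concatInput_of_le _ _ _ _ hi.le, concatInput_of_lt hi]
  · refine Finset.sum_congr rfl fun i _ => ?_
    rw [predictedState_concatInput_add, concatInput_add, add_assoc]

lemma cost_succ' (N : ℕ) (x : EuclideanSpace ℝ (Fin n))
    (u : ℕ → EuclideanSpace ℝ (Fin m)) (k : ℕ) :
    P.cost (N + 1) x u k =
      P.stageCost x u k 0 + P.cost N (P.f x (u 0)) (fun j => u (j + 1)) (k + 1) := by
  rw [cost, Finset.sum_range_succ', add_comm]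
  congr 1
  refine Finset.sum_congr rfl fun i _ => ?_
  rw [predictedState_succ', show k + (i + 1) = k + 1 + i by omega]

variable {P}

lemma FeasibleReference.predictedState_eq (href : P.FeasibleReference) (k i : ℕ) :
    predictedState P.f (P.xr k) (fun j => P.ur (k + j)) i = P.xr (k + i) := by
  induction i with
  | zero => rfl
  | succ i ih => rw [predictedState, ih, ← add_assoc, href]

lemma FeasibleReference.cost_eq_zero (href : P.FeasibleReference) (N k : ℕ) :
    P.cost N (P.xr k) (fun j => P.ur (k + j)) k = 0 := by
  refine Finset.sum_eq_zero fun i _ => ?_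
  rw [href.predictedState_eq]
  simp [weightedSq]

lemma weightedSq_nonneg {d : ℕ} {Q : Matrix (Fin d) (Fin d) ℝ} (hQ : Q.PosDef)
    (x : EuclideanSpace ℝ (Fin d)) : 0 ≤ weightedSq Q x := by
  obtain ⟨A, hA, -⟩ := hQ.exists_weightedSq_eq
  rw [hA]
  positivity

lemma stageCost_nonneg (hQ : P.Q.PosDef) (hR : P.R.PosDef) (x : EuclideanSpace ℝ (Fin n))
    (u : ℕ → EuclideanSpace ℝ (Fin m)) (k i : ℕ) : 0 ≤ P.stageCost x u k i :=
  add_nonneg (weightedSq_nonneg hQ _) (weightedSq_nonneg hR _)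

lemma cost_nonneg (hQ : P.Q.PosDef) (hR : P.R.PosDef) (N : ℕ) (x : EuclideanSpace ℝ (Fin n))
    (u : ℕ → EuclideanSpace ℝ (Fin m)) (k : ℕ) : 0 ≤ P.cost N x u k :=
  Finset.sum_nonneg fun i _ => stageCost_nonneg hQ hR x u k i

lemma value_le_cost (hQ : P.Q.PosDef) (hR : P.R.PosDef) (N : ℕ) (x : EuclideanSpace ℝ (Fin n))
    (u : ℕ → EuclideanSpace ℝ (Fin m)) (k : ℕ) : P.value N x k ≤ P.cost N x u k :=
  ciInf_le ⟨0, by rintro _ ⟨v, rfl⟩; exact cost_nonneg hQ hR N x v k⟩ u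

lemma IsOptimal.value_eq {N : ℕ} {x : EuclideanSpace ℝ (Fin n)} {k : ℕ}
    {u : ℕ → EuclideanSpace ℝ (Fin m)} (hQ : P.Q.PosDef) (hR : P.R.PosDef)
    (hu : P.IsOptimal N x k u) : P.value N x k = P.cost N x u k :=
  le_antisymm (value_le_cost hQ hR N x u k) (le_ciInf hu)

/-- Every control sequence from `y` can be imitated from `x`, so that the square root of the cost
grows by at most `L * ‖x - y‖`, uniformly in horizon and time. -/
lemma exists_sqrt_cost_le (hQ : P.Q.PosDef) (hR : P.R.PosDef)
    (hstab : LocallyIncrementallyStabilizable P.f) :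
    ∃ L : ℝ, 0 < L ∧ ∀ (N k : ℕ) (x y : EuclideanSpace ℝ (Fin n))
      (u : ℕ → EuclideanSpace ℝ (Fin m)), ∃ v : ℕ → EuclideanSpace ℝ (Fin m),
        √(P.cost N x v k) ≤ √(P.cost N y u k) + L * ‖x - y‖ := by
  obtain ⟨A, hA, -⟩ := hQ.exists_weightedSq_eq
  obtain ⟨B, hB, -⟩ := hR.exists_weightedSq_eq
  obtain ⟨K, r, hK, hr, hr1, htrack⟩ := hstab.exists_canTrack
  have hS : Summable fun i => (r ^ 2) ^ i :=
    summable_geometric_of_lt_one (by positivity) (by nlinarith)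
  set S := ∑' i, (r ^ 2) ^ i
  have hS0 : 0 ≤ S := tsum_nonneg fun i => by positivity
  refine ⟨(‖A‖ + ‖B‖ + 1) * K * √S + 1, by positivity, fun N k x y u => ?_⟩
  obtain ⟨v, hv⟩ := htrack x y u
  refine ⟨v, ?_⟩
  set D := (‖A‖ + ‖B‖ + 1) * K * ‖x - y‖ with hD
  -- State and input errors are put into one vector, so that a single Minkowski inequality covers
  -- both.
  let s := (Finset.range N).disjSum (Finset.range N)
  let a : ℕ ⊕ ℕ → ℝ := Sum.elim (fun i => ‖A (predictedState P.f y u i - P.xr (k + i))‖)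
    (fun i => ‖B (u i - P.ur (k + i))‖)
  let b : ℕ ⊕ ℕ → ℝ := Sum.elim (fun i => ‖A (predictedState P.f x v i - predictedState P.f y u i)‖)
    (fun i => ‖B (v i - u i)‖)
  have ha : ∑ i ∈ s, a i ^ 2 = P.cost N y u k := by
    simp only [s, a, Finset.sum_disjSum, Sum.elim_inl, Sum.elim_inr, cost, hA, hB,
      Finset.sum_add_distrib]
  have hc : P.cost N x v k ≤ ∑ i ∈ s, (a i + b i) ^ 2 := by
    simp only [s, a, b, Finset.sum_disjSum, Sum.elim_inl, Sum.elim_inr, cost, hA, hB,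
      Finset.sum_add_distrib]
    gcongr with i _ i _
    · rw [← sub_add_sub_cancel _ (predictedState P.f y u i), map_add, add_comm]
      exact norm_add_le _ _
    · rw [← sub_add_sub_cancel _ (u i), map_add, add_comm]
      exact norm_add_le _ _
  have hb : ∑ i ∈ s, b i ^ 2 ≤ D ^ 2 * S := by
    calc ∑ i ∈ s, b i ^ 2
        ≤ ∑ i ∈ Finset.range N, D ^ 2 * (r ^ 2) ^ i := by
          simp only [s, b, Finset.sum_disjSum, Sum.elim_inl, Sum.elim_inr,
            ← Finset.sum_add_distrib]
          refine Finset.sum_le_sum fun i _ => ?_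
          set e := K * r ^ i * ‖x - y‖
          have he : 0 ≤ e := by positivity
          have h1 : ‖A (predictedState P.f x v i - predictedState P.f y u i)‖ ≤ ‖A‖ * e :=
            (A.le_opNorm _).trans (by gcongr; exact (hv i).1)
          have h2 : ‖B (v i - u i)‖ ≤ ‖B‖ * e := (B.le_opNorm _).trans (by gcongr; exact (hv i).2)
          have h3 : D ^ 2 * (r ^ 2) ^ i = ((‖A‖ + ‖B‖ + 1) * e) ^ 2 := by
            rw [hD, ← pow_mul, mul_comm 2 i, pow_mul]; ring
          rw [h3]
          calc _ ≤ (‖A‖ * e) ^ 2 + (‖B‖ * e) ^ 2 := by gcongr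
            _ ≤ (‖A‖ * e + ‖B‖ * e + e) ^ 2 := by
              have : 0 ≤ ‖A‖ * e := by positivity
              have : 0 ≤ ‖B‖ * e := by positivity
              nlinarith [mul_nonneg ‹0 ≤ ‖A‖ * e› ‹0 ≤ ‖B‖ * e›,
                mul_nonneg ‹0 ≤ ‖A‖ * e› he, mul_nonneg ‹0 ≤ ‖B‖ * e› he]
            _ = _ := by ring
      _ = D ^ 2 * ∑ i ∈ Finset.range N, (r ^ 2) ^ i := by rw [Finset.mul_sum]
      _ ≤ D ^ 2 * S := by
          gcongr
          exact hS.sum_le_tsum _ fun i _ => by positivity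
  have hsb : √(∑ i ∈ s, b i ^ 2) ≤ D * √S := by
    refine (Real.sqrt_le_sqrt hb).trans_eq ?_
    rw [Real.sqrt_mul (sq_nonneg _), Real.sqrt_sq (by positivity)]
  calc √(P.cost N x v k) ≤ √(∑ i ∈ s, (a i + b i) ^ 2) := Real.sqrt_le_sqrt hc
    _ ≤ √(∑ i ∈ s, a i ^ 2) + √(∑ i ∈ s, b i ^ 2) :=
        sqrt_sum_add_sq_le s a b (by rintro (i | i) <;> exact norm_nonneg _)
          (by rintro (i | i) <;> exact norm_nonneg _)
    _ ≤ √(P.cost N y u k) + D * √S := by rw [ha]; gcongr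
    _ ≤ _ := by rw [hD]; nlinarith [norm_nonneg (x - y)]

/-- The square root of the optimal cost is globally Lipschitz. -/
lemma sqrt_value_le (hQ : P.Q.PosDef) (hR : P.R.PosDef) {L : ℝ}
    (hL : ∀ (N k : ℕ) (x y : EuclideanSpace ℝ (Fin n))
      (u : ℕ → EuclideanSpace ℝ (Fin m)), ∃ v : ℕ → EuclideanSpace ℝ (Fin m),
        √(P.cost N x v k) ≤ √(P.cost N y u k) + L * ‖x - y‖)
    (N k : ℕ) (x y : EuclideanSpace ℝ (Fin n)) :
    √(P.value N x k) ≤ √(P.value N y k) + L * ‖x - y‖ := by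
  rw [← sub_le_iff_le_add]
  rcases le_or_gt (√(P.value N x k) - L * ‖x - y‖) 0 with h | h
  · exact h.trans (Real.sqrt_nonneg _)
  · refine (Real.le_sqrt' h).mpr (le_ciInf fun u => ?_)
    obtain ⟨v, hv⟩ := hL N k x y u
    rw [← Real.le_sqrt' h, sub_le_iff_le_add]
    exact (Real.sqrt_le_sqrt (value_le_cost hQ hR N x v k)).trans hv

/-- For a long horizon the optimal cost decreases by a fixed factor along the undisturbed
closed loop. -/
lemma exists_cost_le_mul (hQ : P.Q.PosDef) (hR : P.R.PosDef) {γ : ℝ} (hγ : 1 ≤ γ)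
    (hbound : ∀ (N k : ℕ) (x : EuclideanSpace ℝ (Fin n)),
      ∃ v : ℕ → EuclideanSpace ℝ (Fin m), P.cost N x v k ≤ γ * weightedSq P.Q (x - P.xr k))
    {M : ℕ} (hM : 2 * γ ^ 2 ≤ M) {k : ℕ} {x : EuclideanSpace ℝ (Fin n)}
    {u : ℕ → EuclideanSpace ℝ (Fin m)} (hu : P.IsOptimal (M + 1) x k u) :
    ∃ v : ℕ → EuclideanSpace ℝ (Fin m), P.cost (M + 1) (P.f x (u 0)) v (k + 1) ≤
      (1 - 1 / (2 * γ)) * P.value (M + 1) x k := by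
  have hM0 : (0 : ℝ) < M := by nlinarith
  set y := P.f x (u 0) with hy
  set u' : ℕ → EuclideanSpace ℝ (Fin m) := fun j => u (j + 1)
  set q := weightedSq P.Q (x - P.xr k) with hq
  obtain ⟨v₀, hv₀⟩ := hbound (M + 1) k x
  have hV : P.cost (M + 1) x u k ≤ γ * q := (hu v₀).trans hv₀
  have hsplit := P.cost_succ' M x u k
  have hstage : q ≤ P.stageCost x u k 0 := le_add_of_nonneg_right (weightedSq_nonneg hR _)
  have htail : P.cost M y u' (k + 1) ≤ γ * q := by
    have := stageCost_nonneg hQ hR x u k 0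
    linarith
  -- Pigeonhole: `M` stages cost at most `γ q` together, so one of them is cheap.
  obtain ⟨j, hj, hjle⟩ : ∃ j ∈ Finset.range M, P.stageCost y u' (k + 1) j ≤ γ * q / M := by
    refine Finset.exists_le_of_sum_le (Finset.nonempty_range_iff.mpr (by rintro rfl; simp at hM0)) ?_
    rw [Finset.sum_const, Finset.card_range, nsmul_eq_mul, mul_div_cancel₀ _ hM0.ne']
    exact htail
  have hj := Finset.mem_range.mp hj
  -- From the cheap stage on, a control is used whose whole cost is at most `γ * (γ * q / M) ≤ q /
  -- 2`. Dropping the old first stage saves at least `q`, so the net gain is at least `q / 2`, hence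
  -- at least `V_N / (2γ)`.
  obtain ⟨v, hv⟩ := hbound (M + 1 - j) (k + 1 + j) (predictedState P.f y u' j)
  refine ⟨concatInput j u' v, ?_⟩
  have hcc := P.cost_concatInput j (M + 1 - j) y u' v (k + 1)
  rw [show j + (M + 1 - j) = M + 1 by omega] at hcc
  have hmono : P.cost j y u' (k + 1) ≤ P.cost M y u' (k + 1) :=
    Finset.sum_le_sum_of_subset_of_nonneg (Finset.range_mono hj.le)
      fun i _ _ => stageCost_nonneg hQ hR y u' (k + 1) i
  have hstagej : weightedSq P.Q (predictedState P.f y u' j - P.xr (k + 1 + j)) ≤ γ * q / M :=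
    (le_add_of_nonneg_right (weightedSq_nonneg hR _)).trans hjle
  have hq0 : 0 ≤ q := weightedSq_nonneg hQ _
  have hhalf : γ * (γ * q / M) ≤ q / 2 := by
    rw [show γ * (γ * q / M) = γ ^ 2 * q / M by ring, div_le_iff₀ hM0]
    nlinarith
  have hlow : 1 / (2 * γ) * P.cost (M + 1) x u k ≤ q / 2 := by
    rw [one_div_mul_eq_div, div_le_iff₀ (by positivity)]
    linarith
  have hstagej' := mul_le_mul_of_nonneg_left hstagej (zero_le_one.trans hγ)
  rw [hcc, hu.value_eq hQ hR]
  linarith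

lemma mul_norm_le_sqrt_value (hQ : P.Q.PosDef) (hR : P.R.PosDef) {c : ℝ}
    (hlow : ∀ x, (c * ‖x‖) ^ 2 ≤ weightedSq P.Q x) {N : ℕ} (hN : 0 < N) (k : ℕ)
    (x : EuclideanSpace ℝ (Fin n)) : c * ‖x - P.xr k‖ ≤ √(P.value N x k) := by
  refine Real.le_sqrt_of_sq_le (le_ciInf fun u => (hlow _).trans ?_)
  obtain ⟨N, rfl⟩ := Nat.exists_eq_add_of_lt hN
  rw [zero_add, cost_succ', stageCost, add_assoc]
  exact le_add_of_nonneg_right (add_nonneg (weightedSq_nonneg hR _) (cost_nonneg hQ hR ..))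

/-- Along the perturbed closed loop the square root of the optimal cost contracts up to a term
proportional to the disturbance. -/
lemma exists_sqrt_value_succ_le (hQ : P.Q.PosDef) (hR : P.R.PosDef)
    (href : P.FeasibleReference) {L : ℝ} (hL0 : 0 < L)
    (hL : ∀ (N k : ℕ) (x y : EuclideanSpace ℝ (Fin n))
      (u : ℕ → EuclideanSpace ℝ (Fin m)), ∃ v : ℕ → EuclideanSpace ℝ (Fin m),
        √(P.cost N x v k) ≤ √(P.cost N y u k) + L * ‖x - y‖)
    {c : ℝ} (hc : 0 < c) (hlow : ∀ x, (c * ‖x‖) ^ 2 ≤ weightedSq P.Q x) :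
    ∃ N₀ : ℕ, 0 < N₀ ∧ ∃ μ : ℝ, 0 < μ ∧ μ < 1 ∧ ∀ N, N₀ ≤ N →
      ∀ w x : ℕ → EuclideanSpace ℝ (Fin n), P.IsClosedLoop N w x → ∀ k,
        √(P.value N (x (k + 1)) (k + 1)) ≤ μ * √(P.value N (x k) k) + L * ‖w k‖ := by
  -- The cost is at most `(L‖x - x_r‖)²`, and `c` converts this norm into the stage cost; the `+ 1`
  -- ensures `1 ≤ γ`.
  set γ := L ^ 2 / c ^ 2 + 1 with hγ
  have hγ1 : 1 ≤ γ := le_add_of_nonneg_left (by positivity)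
  have hbound : ∀ (N k : ℕ) (x : EuclideanSpace ℝ (Fin n)),
      ∃ v : ℕ → EuclideanSpace ℝ (Fin m), P.cost N x v k ≤ γ * weightedSq P.Q (x - P.xr k) := by
    intro N k x
    obtain ⟨v, hv⟩ := hL N k x (P.xr k) fun j => P.ur (k + j)
    refine ⟨v, ?_⟩
    rw [href.cost_eq_zero, Real.sqrt_zero, zero_add, Real.sqrt_le_left (by positivity)] at hv
    have h0 := weightedSq_nonneg hQ (x - P.xr k)
    calc P.cost N x v k ≤ L ^ 2 / c ^ 2 * (c * ‖x - P.xr k‖) ^ 2 := by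
          refine hv.trans_eq ?_; field_simp
      _ ≤ L ^ 2 / c ^ 2 * weightedSq P.Q (x - P.xr k) := by gcongr; exact hlow _
      _ ≤ _ := by rw [hγ]; linarith
  obtain ⟨M₀, hM₀⟩ := exists_nat_ge (2 * γ ^ 2)
  have hfrac : 1 / (2 * γ) ≤ 1 / 2 := one_div_le_one_div_of_le (by norm_num) (by linarith)
  have hfrac0 : 0 < 1 / (2 * γ) := by positivity
  refine ⟨M₀ + 1, by omega, √(1 - 1 / (2 * γ)), Real.sqrt_pos.mpr (by linarith),
    by rw [Real.sqrt_lt' one_pos]; linarith, fun N hN w x hx k => ?_⟩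
  obtain ⟨M, rfl⟩ : ∃ M, N = M + 1 := ⟨N - 1, by omega⟩
  have hM : 2 * γ ^ 2 ≤ (M : ℝ) := hM₀.trans (by exact_mod_cast (by omega : M₀ ≤ M))
  obtain ⟨u, hu, hstep⟩ := hx k
  obtain ⟨v, hv⟩ := exists_cost_le_mul hQ hR hγ1 hbound hM hu
  have h1 := sqrt_value_le hQ hR hL (M + 1) (k + 1) (x (k + 1)) (P.f (x k) (u 0))
  rw [show x (k + 1) - P.f (x k) (u 0) = w k by rw [hstep, add_sub_cancel_left]] at h1
  refine h1.trans ?_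
  rw [← Real.sqrt_mul (by linarith)]
  gcongr
  exact (value_le_cost hQ hR _ _ v _).trans hv

lemma infDist_errorSublevel_eq_zero {N k : ℕ} {v : ℝ} {x : EuclideanSpace ℝ (Fin n)}
    (h : P.value N x k ≤ v) : Metric.infDist (x - P.xr k) (P.errorSublevel N k v) = 0 :=
  Metric.infDist_zero_of_mem ⟨x, rfl, h⟩

lemma FeasibleReference.zero_mem_errorSublevel (href : P.FeasibleReference) (hQ : P.Q.PosDef)
    (hR : P.R.PosDef) (N k : ℕ) {v : ℝ} (hv : 0 ≤ v) : 0 ∈ P.errorSublevel N k v :=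
  ⟨P.xr k, by simp, (value_le_cost hQ hR N _ _ k).trans ((href.cost_eq_zero N k).le.trans hv)⟩

end TrackingMPC

/-! ### The scalar recursion and the conclusion. -/

/-- A sequence with `W (k + 1) ≤ μ * W k + (1 - μ) / 2 * s` that starts below `s / lam`, where
`lam = (1 + μ) / 2`, is below `s` from time one on; in general it is below `s` or has decayed by
`lam ^ k`. -/
lemma le_or_le_pow_mul_of_succ_le {W : ℕ → ℝ} {μ s : ℝ} (hμ : 0 < μ) (hμ1 : μ < 1) (hs : 0 ≤ s)
    (hW : ∀ k, W (k + 1) ≤ μ * W k + (1 - μ) / 2 * s) (k : ℕ) :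
    W (k + 1) ≤ s ∨ s < (1 + μ) / 2 * W 0 ∧ W (k + 1) ≤ ((1 + μ) / 2) ^ (k + 1) * W 0 := by
  induction k with
  | zero =>
    have h0 := hW 0
    rcases le_or_gt ((1 + μ) / 2 * W 0) s with h | h
    · left
      rcases le_or_gt (W 0) s with h' | h' <;> nlinarith
    · rcases le_or_gt (W 0) s with h' | h'
      · left; nlinarith
      -- Above `s` the disturbance term is at most `(1 - μ) / 2 * W 0`, which turns the factor `μ`
      -- into `(1 + μ) / 2`.
      · right; exact ⟨h, by rw [zero_add, pow_one]; nlinarith⟩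
  | succ k ih =>
    have h1 := hW (k + 1)
    rcases le_or_gt (W (k + 1)) s with h | h
    · left; nlinarith
    · obtain ⟨h2, h3⟩ := ih.resolve_left h.not_ge
      refine Or.inr ⟨h2, ?_⟩
      calc W (k + 1 + 1) ≤ (1 + μ) / 2 * W (k + 1) := by nlinarith
        _ ≤ (1 + μ) / 2 * (((1 + μ) / 2) ^ (k + 1) * W 0) := by gcongr
        _ = _ := by ring

lemma isClassK_mul_sq {a : ℝ} (ha : 0 < a) : IsClassK fun b => (a * b) ^ 2 := by
  refine ⟨by fun_prop, fun x hx y _ hxy => ?_, by simp⟩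
  have hx : 0 ≤ x := hx
  show (a * x) ^ 2 < (a * y) ^ 2
  gcongr

theorem mainTheorem7 {n m : ℕ} (P : TrackingMPC n m)
    (hQ : P.Q.PosDef) (hR : P.R.PosDef)
    (href : P.FeasibleReference)
    (hstab : LocallyIncrementallyStabilizable P.f) :
    ∀ cx : ℝ, 0 < cx →
      ∃ wbar : ℝ, 0 < wbar ∧
      ∃ N₀ : ℕ, 0 < N₀ ∧ ∀ N : ℕ, N₀ ≤ N →
      ∃ VRPI : ℝ → ℝ, IsClassK VRPI ∧
      ∃ C lam : ℝ, 0 < C ∧ 0 < lam ∧ lam < 1 ∧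
      ∀ b : ℝ, 0 ≤ b → b ≤ wbar →
      ∀ w x : ℕ → EuclideanSpace ℝ (Fin n),
        P.IsClosedLoop N w x →
        ‖x 0 - P.xr 0‖ ≤ cx →
        (∀ k, ‖w k‖ ≤ b) →
        ∀ k : ℕ,
          Metric.infDist (x k - P.xr k) (P.errorSublevel N k (VRPI b)) ≤
            C * lam ^ k *
              Metric.infDist (x 0 - P.xr 0) (P.errorSublevel N 0 (VRPI b)) := by
  intro cx _
  obtain ⟨A, hA, c, hc, hcA⟩ := hQ.exists_weightedSq_eq
  have hlow : ∀ x, (c * ‖x‖) ^ 2 ≤ weightedSq P.Q x := fun x => by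
    rw [hA]; exact pow_le_pow_left₀ (by positivity) (hcA x) 2
  obtain ⟨L, hL0, hL⟩ := TrackingMPC.exists_sqrt_cost_le hQ hR hstab
  obtain ⟨N₀, hN₀, μ, hμ, hμ1, hdec⟩ :=
    TrackingMPC.exists_sqrt_value_succ_le hQ hR href hL0 hL hc hlow
  have hμ' : 0 < 1 - μ := by linarith
  -- All estimates are global, so any positive disturbance bound would do. The `1 +` in the constant
  -- covers time zero.
  refine ⟨1, one_pos, N₀, hN₀, fun N hN => ⟨fun b => (2 * L / (1 - μ) * b) ^ 2,
    isClassK_mul_sq (by positivity), 1 + L / (c * ((1 - μ) / 2)), (1 + μ) / 2, by positivity,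
    by linarith, by linarith, fun b hb _ w x hx _ hw k => ?_⟩⟩
  set s := 2 * L / (1 - μ) * b with hs
  have hs0 : 0 ≤ s := by positivity
  set d := Metric.infDist (x 0 - P.xr 0) (P.errorSublevel N 0 (s ^ 2)) with hd
  have hd0 : 0 ≤ d := Metric.infDist_nonneg
  have hCpos : 0 ≤ L / (c * ((1 - μ) / 2)) := by positivity
  have hzero : ∀ k, 0 ∈ P.errorSublevel N k (s ^ 2) := fun k =>
    href.zero_mem_errorSublevel hQ hR N k (sq_nonneg s)
  rcases k with _ | k
  · rw [pow_zero, mul_one]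
    exact le_mul_of_one_le_left hd0 (by linarith)
  have hW : ∀ k, √(P.value N (x (k + 1)) (k + 1)) ≤
      μ * √(P.value N (x k) k) + (1 - μ) / 2 * s := fun k => by
    refine (hdec N hN w x hx k).trans ?_
    rw [show (1 - μ) / 2 * s = L * b by rw [hs]; field_simp]
    gcongr
    exact hw k
  rcases le_or_le_pow_mul_of_succ_le (W := fun k => √(P.value N (x k) k)) hμ hμ1 hs0 hW k with
    h | ⟨h, hk⟩
  · rw [TrackingMPC.infDist_errorSublevel_eq_zero ((Real.sqrt_le_left hs0).mp h)]
    positivity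
  -- `W` is at most `s` on the sublevel set, and the Lipschitz bound passes to the infimum over its
  -- points.
  · have hlip : √(P.value N (x 0) 0) ≤ s + L * d := by
      rw [← sub_le_iff_le_add', ← div_le_iff₀' hL0, hd]
      refine (Metric.le_infDist ⟨0, hzero 0⟩).mpr ?_
      rintro _ ⟨y, rfl, hy⟩
      rw [div_le_iff₀' hL0, sub_le_iff_le_add', dist_sub_right, dist_eq_norm]
      refine (TrackingMPC.sqrt_value_le hQ hR hL N 0 (x 0) y).trans ?_
      gcongr
      exact (Real.sqrt_le_left hs0).mpr hy
    -- Subtracting `s < (1 + μ) / 2 * W 0` from `hlip` removes the offset `s`.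
    have h0 : (1 - μ) / 2 * √(P.value N (x 0) 0) ≤ L * d := by linarith
    have hnorm := TrackingMPC.mul_norm_le_sqrt_value hQ hR hlow (hN₀.trans_le hN) (k + 1)
      (x (k + 1))
    calc Metric.infDist (x (k + 1) - P.xr (k + 1)) (P.errorSublevel N (k + 1) (s ^ 2))
        ≤ ‖x (k + 1) - P.xr (k + 1)‖ := by
          simpa using Metric.infDist_le_dist_of_mem (x := x (k + 1) - P.xr (k + 1)) (hzero (k + 1))
      _ ≤ ((1 + μ) / 2) ^ (k + 1) * √(P.value N (x 0) 0) / c := by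
          rw [le_div_iff₀' hc]
          exact hnorm.trans hk
      _ ≤ ((1 + μ) / 2) ^ (k + 1) * (L * d / ((1 - μ) / 2)) / c := by
          gcongr
          rwa [le_div_iff₀' (by linarith)]
      _ = L / (c * ((1 - μ) / 2)) * ((1 + μ) / 2) ^ (k + 1) * d := by field_simp
      _ ≤ _ := by gcongr; linarith
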